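/- Let $r\in\mathbb N_0$, let $D\subset\mathbb R$ be open, and let $f:D\to\mathbb R$ be $(r+1)$-times continuously differentiable. Put $$F(w,y)=\sum_{j=0}^{r}\frac{f^{(j)}(y)}{j!}\,w^j,\qquad (w,y)\in\mathbb R\times D.$$ For $y\in D$ let $h\mapsto w(h,y)$ be the maximally extended solution (forward and backward in $h$) of $$\frac{\partial w}{\partial h}(h,y)=F(w(h,y),y),\qquad w(0,y)=0,$$ let $U_{\max}\subset\mathbb R\times D$ be the set of all $(h,y)$ with $y \in D$ such that $h$ lies in the maximal interval of existence of $w(\cdot,y)$, and define $\Phi:U_{\max}\to\mathbb R$ by $\Phi(h,y)=y+w(h,y)$. Then: 1. $U_{\max}$ is open in $\mathbb R^2$, and for every $k\in\mathbb N_0$ the partial derivative $\partial_h^k\Phi$ exists and is continuously differentiable with respect to $(h,y)$ on $U_{\max}$. 2. For every compact subset $K\subset D$ there exists $h_0>0$ such that $[0,h_0]\times K\subset U_{\max}$ (that is, $\Phi$ is defined on $[0,h_0]\times K$), and $\frac{\partial\Phi}{\partial h}$ satisfies a Lipschitz condition with respect to $y$ on $[0,h_0]\times K$: there is a constant $L\ge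 0$ such that $$\Bigl|\frac{\partial\Phi}{\partial h}(h,y_1)-\frac{\partial\Phi}{\partial h}(h,y_2)\Bigr|\le L\,|y_1-y_2|\qquad\text{for all } h\in[0,h_0],\ y_1,y_2\in K.$$ -/

import Mathlib

open Set

/-- The field `F(w, y) = ∑_{j=0}^{r} f^{(j)}(y) / j! * w^j`: the `r`-th order Taylor polynomial of `f`
centered at `y`, evaluated at `y + w`. It is only used at points `y` of an open set on which `f` is
of class `C^{r+1}`, where the iterated derivatives are the usual ones. -/
noncomputable def taylorField (r : ℕ) (f : ℝ → ℝ) (w y : ℝ) : ℝ :=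
  ∑ j ∈ Finset.range (r + 1), iteratedDeriv j f y / (j.factorial : ℝ) * w ^ j

/-- `u` solves `u' = F(u, y)`, `u(0) = 0` on the open interval `(a, b)`, which contains `0`. -/
structure IsTaylorSolution (r : ℕ) (f : ℝ → ℝ) (y a b : ℝ) (u : ℝ → ℝ) : Prop where
  left_neg : a < 0
  right_pos : 0 < b
  initial : u 0 = 0
  hasDerivAt : ∀ h ∈ Ioo a b, HasDerivAt u (taylorField r f (u h) y) h

/-- The maximal domain `U_max`: all `(h, y)` with `y ∈ D` such that `h` lies in the maximal interval
of existence for the parameter `y`, that is, in the union of all open intervals around `0` on which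
a solution exists. -/
def taylorUmax (r : ℕ) (f : ℝ → ℝ) (D : Set ℝ) : Set (ℝ × ℝ) :=
  {p | p.2 ∈ D ∧ ∃ (u : ℝ → ℝ) (a b : ℝ), IsTaylorSolution r f p.2 a b u ∧ p.1 ∈ Ioo a b}

open Classical in
/-- The maximally extended solution `w(h, y)`: the value at `h` of any solution for the parameter `y`
whose interval contains `h` (all of them agree, see `taylorW_eq`); the value `0` off the maximal
domain is never used. -/
noncomputable def taylorW (r : ℕ) (f : ℝ → ℝ) (h y : ℝ) : ℝ :=
  if hu : ∃ (u : ℝ → ℝ) (a b : ℝ), IsTaylorSolution r f y a b u ∧ h ∈ Ioo a b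
  then hu.choose h else 0

/-- The method function `Φ(h, y) = y + w(h, y)`. -/
noncomputable def taylorPhi (r : ℕ) (f : ℝ → ℝ) (h y : ℝ) : ℝ :=
  y + taylorW r f h y

/-- The `k`-th partial derivative of `Φ` with respect to `h`, at `(h, y)`. -/
noncomputable def taylorPhiDeriv (r : ℕ) (f : ℝ → ℝ) (k : ℕ) (h y : ℝ) : ℝ :=
  iteratedDeriv k (fun s => taylorPhi r f s y) h

/-- Two solutions for the same parameter agree wherever both are defined. -/
theorem IsTaylorSolution.unique {r : ℕ} {f : ℝ → ℝ} {y a b a' b' : ℝ} {u v : ℝ → ℝ}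
    (hu : IsTaylorSolution r f y a b u) (hv : IsTaylorSolution r f y a' b' v) {h : ℝ}
    (h1 : h ∈ Ioo a b) (h2 : h ∈ Ioo a' b') : u h = v h := by
  -- a compact interval inside both domains that contains `0` and `h`
  obtain ⟨c, hc, hc0⟩ := exists_between
    (show max a a' < min 0 h from max_lt (lt_min hu.left_neg h1.1) (lt_min hv.left_neg h2.1))
  obtain ⟨d, hd0, hd⟩ := exists_between
    (show max 0 h < min b b' from max_lt (lt_min hu.right_pos hv.right_pos) (lt_min h1.2 h2.2))
  rw [max_lt_iff] at hc hd0
  rw [lt_min_iff] at hc0 hd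
  have mu : ∀ t ∈ Icc c d, t ∈ Ioo a b := fun t ht =>
    ⟨hc.1.trans_le ht.1, ht.2.trans_lt hd.1⟩
  have mv : ∀ t ∈ Icc c d, t ∈ Ioo a' b' := fun t ht =>
    ⟨hc.2.trans_le ht.1, ht.2.trans_lt hd.2⟩
  have cu : ContinuousOn u (Icc c d) := fun t ht =>
    (hu.hasDerivAt t (mu t ht)).continuousAt.continuousWithinAt
  have cv : ContinuousOn v (Icc c d) := fun t ht =>
    (hv.hasDerivAt t (mv t ht)).continuousAt.continuousWithinAt
  obtain ⟨M, hM⟩ := (isCompact_Icc.image_of_continuousOn cu).isBounded.subset_closedBall 0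
  obtain ⟨N, hN⟩ := (isCompact_Icc.image_of_continuousOn cv).isBounded.subset_closedBall 0
  have hC : ContDiff ℝ 1 (fun w => taylorField r f w y) := by
    unfold taylorField; fun_prop
  obtain ⟨K, hK⟩ := hC.contDiffOn.exists_lipschitzOnWith (one_ne_zero)
    (convex_closedBall (0 : ℝ) (max M N)) (isCompact_closedBall (0 : ℝ) (max M N))
  refine ODE_solution_unique_of_mem_Icc (v := fun _ w => taylorField r f w y)
    (s := fun _ => Metric.closedBall (0 : ℝ) (max M N)) (K := K) (t₀ := 0) (a := c) (b := d)
    (fun t _ => hK) ⟨hc0.1, hd0.1⟩ cu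
    (fun t ht => hu.hasDerivAt t (mu t (Ioo_subset_Icc_self ht)))
    (fun t ht => Metric.closedBall_subset_closedBall (le_max_left _ _)
      (hM ⟨t, Ioo_subset_Icc_self ht, rfl⟩)) cv
    (fun t ht => hv.hasDerivAt t (mv t (Ioo_subset_Icc_self ht)))
    (fun t ht => Metric.closedBall_subset_closedBall (le_max_right _ _)
      (hN ⟨t, Ioo_subset_Icc_self ht, rfl⟩))
    (hu.initial.trans hv.initial.symm) ⟨hc0.2.le, hd0.2.le⟩

/-- `w(·, y)` agrees with every solution for the parameter `y` on its interval. -/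
theorem taylorW_eq {r : ℕ} {f : ℝ → ℝ} {y a b : ℝ} {u : ℝ → ℝ}
    (hu : IsTaylorSolution r f y a b u) {h : ℝ} (hh : h ∈ Ioo a b) :
    taylorW r f h y = u h := by
  have hex : ∃ (u : ℝ → ℝ) (a b : ℝ), IsTaylorSolution r f y a b u ∧ h ∈ Ioo a b :=
    ⟨u, a, b, hu, hh⟩
  obtain ⟨a', b', h', hh'⟩ := hex.choose_spec
  rw [taylorW, dif_pos hex]
  exact h'.unique hu hh' hh

/-- `w` solves the differential equation on the whole maximal domain. -/
theorem taylorW_hasDerivAt {r : ℕ} {f : ℝ → ℝ} {D : Set ℝ} {h y : ℝ}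
    (hp : (h, y) ∈ taylorUmax r f D) :
    HasDerivAt (fun s => taylorW r f s y) (taylorField r f (taylorW r f h y) y) h := by
  obtain ⟨-, u, a, b, hu, hh⟩ := hp
  rw [taylorW_eq hu hh]
  exact (hu.hasDerivAt h hh).congr_of_eventuallyEq
    (Filter.eventually_of_mem (isOpen_Ioo.mem_nhds hh) fun s hs => taylorW_eq hu hs)

open Filter Topology Metric MeasureTheory

/-! The field `F` is a polynomial in `w` whose coefficients are `C¹` in `y`, hence jointly `C¹`.
Clamping `w` to a compact interval makes it bounded and Lipschitz, so solutions of the clamped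
equation exist for as long as needed. By Gronwall they stay close to a given solution when the
parameters are close, where the clamp does nothing. Thus `IsTaylorSolution.exists_nearby` yields
openness of the maximal domain and continuity of `w`.

For differentiability in `y`, Hadamard's lemma turns the difference of two solutions into the
solution of a linear equation with continuous coefficients. Variation of constants factors out `y₁ -
y₂`, and the cofactor on the diagonal is `∂w/∂y`. Both partial derivatives are continuous, so `w` is
`C¹`.

Each `∂_h^k Φ` is a polynomial in `w` with `C¹` coefficients: differentiating in `h` never
differentiates the coefficients, so no regularity is lost. The Lipschitz bound follows from
compactness. -/

/-! ### Tools: Picard–Lindelöf, Gronwall, Hadamard, linear equations -/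

theorem exists_hasDerivAt_of_bounded_lipschitz {g : ℝ → ℝ} {K B : NNReal}
    (hl : LipschitzWith K g) (hb : ∀ x, |g x| ≤ B) {c d : ℝ} (hc : c < 0) (hd : 0 < d) :
    ∃ u : ℝ → ℝ, u 0 = 0 ∧ ∀ t ∈ Ioo c d, HasDerivAt u (g (u t)) t := by
  -- The ball has radius `B` times the longest time, so the interval need not be small.
  have hpl : IsPicardLindelof (fun _ => g) (tmin := c) (tmax := d) ⟨0, hc.le, hd.le⟩ (0 : ℝ)
      (B * (max d (-c)).toNNReal) 0 B K :=
    IsPicardLindelof.of_time_independent (fun x _ => hb x) hl.lipschitzOnWith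
      (by simp [Real.coe_toNNReal _ (hd.le.trans (le_max_left d (-c)))])
  obtain ⟨u, hu0, hu⟩ := hpl.exists_eq_forall_mem_Icc_hasDerivWithinAt₀
  exact ⟨u, hu0, fun t ht =>
    (hu t (Ioo_subset_Icc_self ht)).hasDerivAt (Icc_mem_nhds ht.1 ht.2)⟩

theorem abs_le_gronwallBound_of_abs_deriv_le {g g' : ℝ → ℝ} {c d K ε : ℝ}
    (hg : ∀ t ∈ Icc c d, HasDerivAt g (g' t) t) (h0 : g 0 = 0) (hc : c ≤ 0) (hd : 0 ≤ d)
    (hb : ∀ t ∈ Icc c d, |g' t| ≤ K * |g t| + ε) :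
    ∀ t ∈ Icc c d, |g t| ≤ gronwallBound 0 K ε |t| := by
  have key : ∀ (e : ℝ) (φ φ' : ℝ → ℝ), (∀ t ∈ Icc 0 e, HasDerivAt φ (φ' t) t) → φ 0 = 0 →
      (∀ t ∈ Icc 0 e, |φ' t| ≤ K * |φ t| + ε) →
      ∀ t ∈ Icc 0 e, |φ t| ≤ gronwallBound 0 K ε t := by
    intro e φ φ' hφ hφ0 hφb t ht
    simpa using norm_le_gronwallBound_of_norm_deriv_right_le (f := φ) (f' := φ') (δ := 0)
      (fun s hs => (hφ s hs).continuousAt.continuousWithinAt)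
      (fun s hs => (hφ s (Ico_subset_Icc_self hs)).hasDerivWithinAt) (by simp [hφ0])
      (fun s hs => hφb s (Ico_subset_Icc_self hs)) t ht
  intro t ht
  rcases le_total 0 t with h | h
  · rw [abs_of_nonneg h]
    exact key d g g' (fun s hs => hg s ⟨hc.trans hs.1, hs.2⟩) h0
      (fun s hs => hb s ⟨hc.trans hs.1, hs.2⟩) t ⟨h, ht.2⟩
  · rw [abs_of_nonpos h]
    -- Negative times reduce to positive ones by time reversal.
    have hm : ∀ s ∈ Icc 0 (-c), -s ∈ Icc c d := fun s hs =>
      ⟨by linarith [hs.2], by linarith [hs.1]⟩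
    have := key (-c) (fun s => g (-s)) (fun s => -g' (-s))
      (fun s hs => by simpa using! (hg (-s) (hm s hs)).comp s (hasDerivAt_neg s))
      (by simpa using h0) (fun s hs => by simpa using hb (-s) (hm s hs)) (-t)
      ⟨by linarith, by linarith [ht.1]⟩
    simpa using this

/-- **Hadamard's lemma** with parameters. -/
theorem exists_continuous_sub_eq_apply_sub {X E : Type*} [TopologicalSpace X]
    [FirstCountableTopology X] [LocallyCompactSpace X] [NormedAddCommGroup E] [NormedSpace ℝ E]
    {F : E → ℝ} {U : Set E} (hU : IsOpen U) (hF : ContDiffOn ℝ 1 F U) {p q : X → E}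
    (hp : Continuous p) (hq : Continuous q)
    (hpq : ∀ x, ∀ s ∈ Icc (0 : ℝ) 1, q x + s • (p x - q x) ∈ U) :
    ∃ α : X → E →L[ℝ] ℝ, Continuous α ∧ ∀ x, F (p x) - F (q x) = α x (p x - q x) := by
  -- Clamping `s` keeps the segment in `U`, so the integrand is continuous on all of `X × ℝ`.
  set κ : ℝ → ℝ := fun s => projIcc (0 : ℝ) 1 zero_le_one s
  have hκ : Continuous κ := continuous_subtype_val.comp continuous_projIcc
  have hκm : ∀ s, κ s ∈ Icc (0 : ℝ) 1 := fun s => (projIcc (0 : ℝ) 1 zero_le_one s).2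
  have hκe : ∀ s ∈ Icc (0 : ℝ) 1, κ s = s := fun s hs => by simp [κ, projIcc_of_mem _ hs]
  set G : X → ℝ → E →L[ℝ] ℝ := fun x s => fderiv ℝ F (q x + κ s • (p x - q x))
  have hG : Continuous G.uncurry := by
    refine (hF.continuousOn_fderiv_of_isOpen hU le_rfl).comp_continuous
      (f := fun z : X × ℝ => q z.1 + κ z.2 • (p z.1 - q z.1)) (by fun_prop)
      fun z => hpq _ _ (hκm _)
  refine ⟨fun x => ∫ s in (0 : ℝ)..1, G x s,
    intervalIntegral.continuous_parametric_intervalIntegral_of_continuous' hG 0 1, fun x => ?_⟩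
  have hGx : Continuous (G x) := hG.uncurry_left x
  rw [ContinuousLinearMap.intervalIntegral_apply (hGx.intervalIntegrable _ _),
    intervalIntegral.integral_eq_sub_of_hasDerivAt
      (f := fun s : ℝ => F (q x + s • (p x - q x)))]
  · simp
  · intro s hs
    rw [uIcc_of_le zero_le_one] at hs
    have h1 : HasFDerivAt F (G x s) (q x + s • (p x - q x)) := by
      simp only [G, hκe s hs]
      exact ((hF.differentiableOn one_ne_zero).differentiableAt
        (hU.mem_nhds (hpq x s hs))).hasFDerivAt
    have h2 : HasDerivAt (fun s : ℝ => q x + s • (p x - q x)) (p x - q x) s := by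
      simpa using! ((hasDerivAt_id s).smul_const (p x - q x)).const_add (q x)
    exact h1.comp_hasDerivAt s h2
  · exact (hGx.clm_apply continuous_const).intervalIntegrable _ _

/-- The solution of `g' = A x g + B x`, `g 0 = 0`, given by variation of constants. -/
noncomputable def linearSolution {X : Type*} (A B : X → ℝ → ℝ) (x : X) (h : ℝ) : ℝ :=
  Real.exp (∫ t in (0 : ℝ)..h, A x t) *
    ∫ s in (0 : ℝ)..h, Real.exp (-∫ t in (0 : ℝ)..s, A x t) * B x s

theorem continuous_linearSolution {X : Type*} [TopologicalSpace X]
    [FirstCountableTopology X] [LocallyCompactSpace X] {A B : X → ℝ → ℝ}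
    (hA : Continuous A.uncurry) (hB : Continuous B.uncurry) :
    Continuous (linearSolution A B).uncurry := by
  have hP : Continuous fun p : X × ℝ => ∫ t in (0 : ℝ)..p.2, A p.1 t :=
    intervalIntegral.continuous_parametric_primitive_of_continuous hA
  have hQ : Continuous fun p : X × ℝ =>
      ∫ s in (0 : ℝ)..p.2, Real.exp (-∫ t in (0 : ℝ)..s, A p.1 t) * B p.1 s :=
    intervalIntegral.continuous_parametric_primitive_of_continuous
      (f := fun x s => Real.exp (-∫ t in (0 : ℝ)..s, A x t) * B x s)
      ((Real.continuous_exp.comp hP.neg).mul hB)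
  exact (Real.continuous_exp.comp hP).mul hQ

/-- With the integrating factor `exp (-∫ A)`, the derivative of the product is `exp (-∫ A) * B * η`,
which is then integrated from `0`. -/
theorem eq_mul_linearSolution {X : Type*} [TopologicalSpace X] {A B : X → ℝ → ℝ}
    (hA : Continuous A.uncurry) (hB : Continuous B.uncurry) {x : X} {c d η : ℝ} {g : ℝ → ℝ}
    (hc : c < 0) (hd : 0 < d) (h0 : g 0 = 0)
    (hg : ∀ s ∈ Ioo c d, HasDerivAt g (A x s * g s + B x s * η) s) {h : ℝ} (hh : h ∈ Ioo c d) :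
    g h = η * linearSolution A B x h := by
  have hAx : Continuous (A x) := hA.uncurry_left x
  have hBx : Continuous (B x) := hB.uncurry_left x
  set P : ℝ → ℝ := fun s => ∫ t in (0 : ℝ)..s, A x t with hPdef
  have hP : ∀ s, HasDerivAt P (A x s) s := fun s => hAx.integral_hasStrictDerivAt 0 s |>.hasDerivAt
  have hPc : Continuous P := continuous_iff_continuousAt.2 fun s => (hP s).continuousAt
  have hsub : uIcc 0 h ⊆ Ioo c d := ordConnected_Ioo.uIcc_subset ⟨hc, hd⟩ hh
  have key : ∫ s in (0 : ℝ)..h, (Real.exp (-P s) * B x s) * η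
      = Real.exp (-P h) * g h - Real.exp (-P 0) * g 0 := by
    refine intervalIntegral.integral_eq_sub_of_hasDerivAt
      (f := fun s => Real.exp (-P s) * g s) (fun s hs => ?_) ?_
    · refine ((hP s).neg.exp.mul (hg s (hsub hs))).congr_deriv ?_
      simp only [Pi.neg_apply]
      ring
    · exact (((Real.continuous_exp.comp hPc.neg).mul hBx).mul
        continuous_const).intervalIntegrable _ _
  rw [intervalIntegral.integral_mul_const, h0, mul_zero, sub_zero] at key
  rw [linearSolution, ← mul_assoc, mul_comm η, mul_assoc, mul_comm η, key, ← mul_assoc,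
    ← Real.exp_add]
  simp [P]

/-! ### Regularity of the field -/

theorem ContDiffOn.iteratedDeriv_of_isOpen {f : ℝ → ℝ} {D : Set ℝ} (hD : IsOpen D) (j : ℕ) :
    ∀ m : ℕ, ContDiffOn ℝ ((m + j : ℕ) : WithTop ℕ∞) f D →
      ContDiffOn ℝ (m : WithTop ℕ∞) (iteratedDeriv j f) D := by
  induction j with
  | zero => intro m h; simpa [iteratedDeriv_zero] using h
  | succ j ih =>
    intro m h
    rw [iteratedDeriv_succ]
    exact (ih (m + 1) (by convert h using 2; omega)).deriv_of_isOpen hD (by norm_cast)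

/-- A locally Lipschitz map is Lipschitz on a compact set; convexity of `S` is not needed. -/
theorem ContDiffOn.exists_lipschitzOnWith_of_isCompact {E G : Type*} [NormedAddCommGroup E]
    [NormedSpace ℝ E] [NormedAddCommGroup G] [NormedSpace ℝ G] {g : E → G} {U S : Set E}
    (hg : ContDiffOn ℝ 1 g U) (hU : IsOpen U) (hS : IsCompact S) (hSU : S ⊆ U) :
    ∃ K, LipschitzOnWith K g S := by
  refine LocallyLipschitzOn.exists_lipschitzOnWith_of_compact hS fun x hx => ?_
  obtain ⟨K, t, ht, hK⟩ := (hg.contDiffAt (hU.mem_nhds (hSU hx))).exists_lipschitzOnWith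
  exact ⟨K, t, mem_nhdsWithin_of_mem_nhds ht, hK⟩

theorem contDiffOn_taylorCoeff {r j : ℕ} {f : ℝ → ℝ} {D : Set ℝ} (hD : IsOpen D)
    (hf : ContDiffOn ℝ ((r + 1 : ℕ) : WithTop ℕ∞) f D) (hj : j < r + 1) :
    ContDiffOn ℝ 1 (fun y => iteratedDeriv j f y / (j.factorial : ℝ)) D := by
  have h : ContDiffOn ℝ ((1 : ℕ) : WithTop ℕ∞) (iteratedDeriv j f) D :=
    ContDiffOn.iteratedDeriv_of_isOpen hD j 1 (hf.of_le (by norm_cast; omega))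
  exact ContDiffOn.div_const (by simpa using h) _

theorem contDiffOn_taylorField {r : ℕ} {f : ℝ → ℝ} {D : Set ℝ} (hD : IsOpen D)
    (hf : ContDiffOn ℝ ((r + 1 : ℕ) : WithTop ℕ∞) f D) :
    ContDiffOn ℝ 1 (fun p : ℝ × ℝ => taylorField r f p.1 p.2) (univ ×ˢ D) := by
  unfold taylorField
  refine ContDiffOn.sum fun j hj => ContDiffOn.mul ?_ (by fun_prop)
  exact (contDiffOn_taylorCoeff hD hf (Finset.mem_range.1 hj)).comp contDiffOn_snd
    fun p hp => hp.2

/-! ### Persistence of solutions, openness and continuity -/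

/-- Solutions for nearby parameters exist on a common interval and depend on the parameter in a
Lipschitz way. -/
theorem IsTaylorSolution.exists_nearby {r : ℕ} {f : ℝ → ℝ} {D : Set ℝ} (hD : IsOpen D)
    (hf : ContDiffOn ℝ ((r + 1 : ℕ) : WithTop ℕ∞) f D) {y₀ a b c d : ℝ} {u : ℝ → ℝ}
    (hu : IsTaylorSolution r f y₀ a b u) (hy : y₀ ∈ D) (hac : a < c) (hc : c < 0) (hd : 0 < d)
    (hdb : d < b) :
    ∃ ε > 0, ∃ C, closedBall y₀ ε ⊆ D ∧ ∀ y ∈ closedBall y₀ ε,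
      ∃ v, IsTaylorSolution r f y c d v ∧ ∀ t ∈ Ioo c d, |v t - u t| ≤ C * |y - y₀| := by
  have hu' : ∀ t ∈ Icc c d, HasDerivAt u (taylorField r f (u t) y₀) t := fun t ht =>
    hu.hasDerivAt t ⟨hac.trans_le ht.1, ht.2.trans_lt hdb⟩
  obtain ⟨N, hN⟩ := isCompact_Icc.exists_bound_of_continuousOn
    (fun t ht => (hu' t ht).continuousAt.continuousWithinAt : ContinuousOn u (Icc c d))
  have hN0 : 0 ≤ N := (norm_nonneg _).trans (hN 0 ⟨hc.le, hd.le⟩)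
  -- The extra `1` is the room left for neighbouring solutions.
  set M := N + 1
  have hM : -M ≤ M := by simp only [M]; linarith
  obtain ⟨ε₀, hε₀, hεD⟩ := nhds_basis_closedBall.mem_iff.1 (hD.mem_nhds hy)
  set S : Set (ℝ × ℝ) := Icc (-M) M ×ˢ closedBall y₀ ε₀
  have hS : IsCompact S := isCompact_Icc.prod (isCompact_closedBall _ _)
  have hF := (contDiffOn_taylorField hD hf).mono
    (prod_mono (subset_univ (Icc (-M) M)) hεD)
  obtain ⟨K, hK⟩ := hF.exists_lipschitzOnWith one_ne_zero
    ((convex_Icc _ _).prod (convex_closedBall _ _)) hS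
  obtain ⟨B, hB⟩ := hS.exists_bound_of_continuousOn hF.continuousOn
  set cl : ℝ → ℝ := fun x => projIcc (-M) M hM x
  have hclm : ∀ x, cl x ∈ Icc (-M) M := fun x => (projIcc (-M) M hM x).2
  have hcle : ∀ x ∈ Icc (-M) M, cl x = x := fun x hx => by simp [cl, projIcc_of_mem _ hx]
  have hcll : ∀ x x', |cl x - cl x'| ≤ |x - x'| := fun x x' => by
    simpa [Real.dist_eq, cl, Subtype.dist_eq] using (LipschitzWith.projIcc hM).dist_le_mul x x'
  have hFl : ∀ x x', ∀ y ∈ closedBall y₀ ε₀, ∀ y' ∈ closedBall y₀ ε₀,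
      |taylorField r f (cl x) y - taylorField r f (cl x') y'|
        ≤ K * max |x - x'| |y - y'| := by
    intro x x' y hy y' hy'
    have := hK.dist_le_mul (cl x, y) ⟨hclm x, hy⟩ (cl x', y') ⟨hclm x', hy'⟩
    rw [Prod.dist_eq, Real.dist_eq, Real.dist_eq, Real.dist_eq] at this
    exact this.trans (mul_le_mul_of_nonneg_left (max_le_max (hcll x x') le_rfl) K.2)
  -- A positive rate selects the exponential form of the Gronwall bound; it also dominates `K`.
  set κ : ℝ := K + 1
  have hκ : 0 < κ := by positivity
  set T := max d (-c)
  have hT : 0 ≤ T := hd.le.trans (le_max_left _ _)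
  set C := Real.exp (κ * T) - 1
  have hC : 0 ≤ C := by
    have := Real.one_le_exp (mul_nonneg hκ.le hT)
    simp only [C]; linarith
  -- This radius forces `C * |y - y₀| ≤ 1`, the room available.
  refine ⟨min ε₀ (1 / (C + 1)), by positivity, C,
    (closedBall_subset_closedBall (min_le_left _ _)).trans hεD, fun y hyb => ?_⟩
  have hy0 : y ∈ closedBall y₀ ε₀ := closedBall_subset_closedBall (min_le_left _ _) hyb
  have hyC : C * |y - y₀| ≤ 1 := by
    have h1 : |y - y₀| ≤ 1 / (C + 1) := (mem_closedBall.1 hyb).trans (min_le_right _ _)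
    rw [le_div_iff₀ (by positivity)] at h1
    nlinarith [abs_nonneg (y - y₀)]
  -- The interval is enlarged by `1` on each side to have two-sided derivatives at `c` and `d`.
  obtain ⟨v, hv0, hv⟩ := exists_hasDerivAt_of_bounded_lipschitz (K := K) (B := B.toNNReal)
    (g := fun x => taylorField r f (cl x) y)
    (LipschitzWith.of_dist_le_mul fun x x' => by
      simpa [Real.dist_eq] using hFl x x' y hy0 y hy0)
    (fun x => (hB (cl x, y) ⟨hclm x, hy0⟩).trans (Real.le_coe_toNNReal B))
    (show c - 1 < 0 by linarith) (show 0 < d + 1 by linarith)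
  have hv' : ∀ t ∈ Icc c d, HasDerivAt v (taylorField r f (cl (v t)) y) t := fun t ht =>
    hv t ⟨by linarith [ht.1], by linarith [ht.2]⟩
  have hul : ∀ t ∈ Icc c d, u t ∈ Icc (-N) N := fun t ht => abs_le.1 (hN t ht)
  have hbd : ∀ t ∈ Icc c d, |v t - u t| ≤ C * |y - y₀| := by
    intro t ht
    have h := abs_le_gronwallBound_of_abs_deriv_le (g := fun t => v t - u t) (K := κ)
      (ε := κ * |y - y₀|) (fun s hs => (hv' s hs).sub (hu' s hs)) (by simp [hv0, hu.initial])
      hc.le hd.le (fun s hs => by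
        have hus : cl (u s) = u s := hcle _ ⟨by simp only [M]; linarith [(hul s hs).1],
          by simp only [M]; linarith [(hul s hs).2]⟩
        have h1 := hFl (v s) (u s) y hy0 y₀ (mem_closedBall_self hε₀.le)
        rw [hus] at h1
        refine h1.trans ?_
        have h2 : max |v s - u s| |y - y₀| ≤ |v s - u s| + |y - y₀| :=
          max_le_add_of_nonneg (abs_nonneg _) (abs_nonneg _)
        rw [← mul_add]
        exact mul_le_mul (by simp [κ]) h2 (le_max_of_le_left (abs_nonneg _)) hκ.le) t ht
    refine h.trans ?_
    rw [gronwallBound_of_K_ne_0 hκ.ne']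
    beta_reduce
    rw [zero_mul, zero_add, mul_div_cancel_left₀ _ hκ.ne', mul_comm]
    have ht' : |t| ≤ T := abs_le_max_abs_abs ht.1 ht.2 |>.trans (by
      rw [abs_of_neg hc, abs_of_pos hd, max_comm])
    have hexp : Real.exp (κ * |t|) ≤ Real.exp (κ * T) := by gcongr
    exact mul_le_mul_of_nonneg_right (sub_le_sub_right hexp 1) (abs_nonneg _)
  refine ⟨v, ⟨hc, hd, hv0, fun t ht => ?_⟩, fun t ht => hbd t (Ioo_subset_Icc_self ht)⟩
  have ht' := Ioo_subset_Icc_self ht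
  have h1 := abs_le.1 ((hbd t ht').trans hyC)
  have h2 := hul t ht'
  have := hv' t ht'
  -- Being within `1` of `u`, `v` lies in `[-M, M]`, so the clamp is inactive and `v` solves the
  -- original equation.
  rwa [hcle _ ⟨by simp only [M]; linarith [h1.1, h2.1], by simp only [M]; linarith [h1.2, h2.2]⟩]
    at this

theorem exists_isTaylorSolution (r : ℕ) (f : ℝ → ℝ) (y : ℝ) :
    ∃ (u : ℝ → ℝ) (a b : ℝ), IsTaylorSolution r f y a b u := by
  have hC : ContDiff ℝ 1 (fun w => taylorField r f w y) := by
    unfold taylorField; fun_prop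
  obtain ⟨u, hu0, ε, hε, hu⟩ :=
    (hC.contDiffAt (x := 0)).exists_forall_mem_closedBall_exists_eq_forall_mem_Ioo_hasDerivAt₀ 0
  exact ⟨u, -ε, ε, by linarith, hε, hu0, by simpa using hu⟩

theorem exists_box_of_mem_taylorUmax {r : ℕ} {f : ℝ → ℝ} {D : Set ℝ} (hD : IsOpen D)
    (hf : ContDiffOn ℝ ((r + 1 : ℕ) : WithTop ℕ∞) f D) {h y : ℝ}
    (hp : (h, y) ∈ taylorUmax r f D) :
    ∃ c d ε C : ℝ, c < 0 ∧ 0 < d ∧ h ∈ Ioo c d ∧ 0 < ε ∧ closedBall y ε ⊆ D ∧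
      Ioo c d ×ˢ closedBall y ε ⊆ taylorUmax r f D ∧
      ∀ t ∈ Ioo c d, ∀ y' ∈ closedBall y ε,
        |taylorW r f t y' - taylorW r f t y| ≤ C * |y' - y| := by
  obtain ⟨hy, u, a, b, hu, hh⟩ := hp
  obtain ⟨c, hac, hc⟩ := exists_between (lt_min hu.left_neg hh.1)
  obtain ⟨d, hd, hdb⟩ := exists_between (max_lt hu.right_pos hh.2)
  rw [lt_min_iff] at hc
  rw [max_lt_iff] at hd
  obtain ⟨ε, hε, C, hεD, hv⟩ := hu.exists_nearby hD hf hy hac hc.1 hd.1 hdb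
  refine ⟨c, d, ε, C, hc.1, hd.1, ⟨hc.2, hd.2⟩, hε, hεD, ?_, fun t ht y' hy' => ?_⟩
  · rintro ⟨t, y'⟩ ⟨ht, hy'⟩
    obtain ⟨v, hv, -⟩ := hv y' hy'
    exact ⟨hεD hy', v, c, d, hv, ht⟩
  · obtain ⟨v, hv, hvu⟩ := hv y' hy'
    rw [taylorW_eq hv ht, taylorW_eq hu ⟨hac.trans ht.1, ht.2.trans hdb⟩]
    exact hvu t ht

theorem isOpen_taylorUmax {r : ℕ} {f : ℝ → ℝ} {D : Set ℝ} (hD : IsOpen D)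
    (hf : ContDiffOn ℝ ((r + 1 : ℕ) : WithTop ℕ∞) f D) : IsOpen (taylorUmax r f D) := by
  refine isOpen_iff_mem_nhds.2 ?_
  rintro ⟨h, y⟩ hp
  obtain ⟨c, d, ε, C, -, -, hh, hε, -, hbox, -⟩ := exists_box_of_mem_taylorUmax hD hf hp
  exact mem_of_superset (prod_mem_nhds (isOpen_Ioo.mem_nhds hh) (closedBall_mem_nhds y hε)) hbox

theorem continuousOn_taylorW {r : ℕ} {f : ℝ → ℝ} {D : Set ℝ} (hD : IsOpen D)
    (hf : ContDiffOn ℝ ((r + 1 : ℕ) : WithTop ℕ∞) f D) :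
    ContinuousOn (fun p : ℝ × ℝ => taylorW r f p.1 p.2) (taylorUmax r f D) := by
  rintro ⟨h, y⟩ hp
  refine ContinuousAt.continuousWithinAt ?_
  obtain ⟨c, d, ε, C, -, -, hh, hε, -, -, hC⟩ := exists_box_of_mem_taylorUmax hD hf hp
  have h1 : Tendsto (fun p : ℝ × ℝ => taylorW r f p.1 p.2 - taylorW r f p.1 y) (𝓝 (h, y))
      (𝓝 0) := by
    refine squeeze_zero_norm' (a := fun p : ℝ × ℝ => C * |p.2 - y|) ?_ ?_
    · filter_upwards [prod_mem_nhds (isOpen_Ioo.mem_nhds hh) (closedBall_mem_nhds y hε)]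
        with p hp using hC p.1 hp.1 p.2 hp.2
    · have : Continuous fun p : ℝ × ℝ => C * |p.2 - y| := by fun_prop
      simpa using this.tendsto (h, y)
  have h2 : Tendsto (fun p : ℝ × ℝ => taylorW r f p.1 y) (𝓝 (h, y)) (𝓝 (taylorW r f h y)) :=
    (taylorW_hasDerivAt hp).continuousAt.tendsto.comp (continuous_fst.tendsto (h, y))
  simpa [ContinuousAt] using h1.add h2

/-! ### Differentiability in the parameter -/

/-- Near each point of the maximal domain, `w(h, y₁) - w(h, y₂)` is `y₁ - y₂` times a continuous
function of `(y₁, y₂, h)`. -/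
theorem exists_continuous_taylorW_sub_eq {r : ℕ} {f : ℝ → ℝ} {D : Set ℝ} (hD : IsOpen D)
    (hf : ContDiffOn ℝ ((r + 1 : ℕ) : WithTop ℕ∞) f D) {h₀ y₀ : ℝ}
    (hp : (h₀, y₀) ∈ taylorUmax r f D) :
    ∃ c d ε : ℝ, h₀ ∈ Ioo c d ∧ 0 < ε ∧ ∃ e : ℝ × ℝ → ℝ → ℝ, Continuous e.uncurry ∧
      ∀ h ∈ Ioo c d, ∀ y₁ ∈ closedBall y₀ ε, ∀ y₂ ∈ closedBall y₀ ε,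
        taylorW r f h y₁ - taylorW r f h y₂ = (y₁ - y₂) * e (y₁, y₂) h := by
  obtain ⟨c', d', ε, -, hc', hd', hh, hε, hεD, hbox, -⟩ := exists_box_of_mem_taylorUmax hD hf hp
  obtain ⟨c, hc'c, hc⟩ := exists_between (lt_min hc' hh.1)
  obtain ⟨d, hd, hdd'⟩ := exists_between (max_lt hd' hh.2)
  rw [lt_min_iff] at hc
  rw [max_lt_iff] at hd
  have hcd : c ≤ d := (hc.1.trans hd.1).le
  have hyy : y₀ - ε ≤ y₀ + ε := by linarith
  rw [Real.closedBall_eq_Icc] at hεD hbox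
  -- Clamping time and parameter makes the coefficients globally continuous. The clamped time can
  -- equal `c` or `d`, hence the strictly larger interval `(c', d')`.
  set κ : ℝ → ℝ := fun s => projIcc c d hcd s
  set μ : ℝ → ℝ := fun s => projIcc (y₀ - ε) (y₀ + ε) hyy s
  have hκ : Continuous κ := continuous_subtype_val.comp continuous_projIcc
  have hμ : Continuous μ := continuous_subtype_val.comp continuous_projIcc
  have hκm : ∀ s, κ s ∈ Ioo c' d' := fun s =>
    ⟨hc'c.trans_le (projIcc c d hcd s).2.1, (projIcc c d hcd s).2.2.trans_lt hdd'⟩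
  have hμm : ∀ s, μ s ∈ Icc (y₀ - ε) (y₀ + ε) := fun s => (projIcc _ _ hyy s).2
  have hκe : ∀ s ∈ Ioo c d, κ s = s := fun s hs => by
    simp [κ, projIcc_of_mem _ (Ioo_subset_Icc_self hs)]
  have hμe : ∀ s ∈ Icc (y₀ - ε) (y₀ + ε), μ s = s := fun s hs => by simp [μ, projIcc_of_mem _ hs]
  have hW : Continuous fun z : ℝ × ℝ => taylorW r f (κ z.1) (μ z.2) :=
    (continuousOn_taylorW hD hf).comp_continuous (f := fun z : ℝ × ℝ => (κ z.1, μ z.2))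
      (by fun_prop) fun z => hbox ⟨hκm _, hμm _⟩
  obtain ⟨α, hα, hαe⟩ := exists_continuous_sub_eq_apply_sub (isOpen_univ.prod hD)
    (contDiffOn_taylorField hD hf) (X := (ℝ × ℝ) × ℝ)
    (p := fun z => (taylorW r f (κ z.2) (μ z.1.1), μ z.1.1))
    (q := fun z => (taylorW r f (κ z.2) (μ z.1.2), μ z.1.2))
    ((hW.comp (f := fun z : (ℝ × ℝ) × ℝ => (z.2, z.1.1)) (by fun_prop)).prodMk (by fun_prop))
    ((hW.comp (f := fun z : (ℝ × ℝ) × ℝ => (z.2, z.1.2)) (by fun_prop)).prodMk (by fun_prop))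
    (fun z s hs => ⟨mem_univ _,
      hεD ((convex_Icc _ _).add_smul_sub_mem (hμm _) (hμm _) hs)⟩)
  set A : ℝ × ℝ → ℝ → ℝ := fun x s => α (x, s) (1, 0)
  set B : ℝ × ℝ → ℝ → ℝ := fun x s => α (x, s) (0, 1)
  have hA : Continuous A.uncurry := hα.clm_apply continuous_const
  have hB : Continuous B.uncurry := hα.clm_apply continuous_const
  refine ⟨c, d, ε, ⟨hc.2, hd.2⟩, hε, linearSolution A B, continuous_linearSolution hA hB,
    fun h hh y₁ hy₁ y₂ hy₂ => ?_⟩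
  rw [Real.closedBall_eq_Icc] at hy₁ hy₂
  have hmem : ∀ t ∈ Ioo c d, ∀ y ∈ Icc (y₀ - ε) (y₀ + ε), (t, y) ∈ taylorUmax r f D :=
    fun t ht y hy => hbox ⟨⟨hc'c.trans ht.1, ht.2.trans hdd'⟩, hy⟩
  have hzero : ∀ y, taylorW r f 0 y = 0 := fun y => by
    obtain ⟨u, a, b, hu⟩ := exists_isTaylorSolution r f y
    rw [taylorW_eq hu ⟨hu.left_neg, hu.right_pos⟩, hu.initial]
  refine eq_mul_linearSolution (x := (y₁, y₂)) hA hB hc.1 hd.1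
    (g := fun t => taylorW r f t y₁ - taylorW r f t y₂) (by simp [hzero]) (fun t ht => ?_) hh
  refine ((taylorW_hasDerivAt (hmem t ht y₁ hy₁)).sub
    (taylorW_hasDerivAt (hmem t ht y₂ hy₂))).congr_deriv ?_
  have h1 := hαe ((y₁, y₂), t)
  simp only [hκe t ht, hμe y₁ hy₁, hμe y₂ hy₂, Prod.mk_sub_mk] at h1
  rw [h1]
  have h2 : ∀ s t : ℝ, ((s, t) : ℝ × ℝ) = s • (1, 0) + t • (0, 1) := fun s t => by simp
  rw [h2 (_ - _), map_add, map_smul, map_smul]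
  simp only [A, B, smul_eq_mul]
  ring

/-- The slope in `y` equals `e (y', y) h`, which tends to `e (y, y) h`; continuous partial
derivatives then give joint `C¹`. -/
theorem contDiffOn_taylorW {r : ℕ} {f : ℝ → ℝ} {D : Set ℝ} (hD : IsOpen D)
    (hf : ContDiffOn ℝ ((r + 1 : ℕ) : WithTop ℕ∞) f D) :
    ContDiffOn ℝ 1 (fun p : ℝ × ℝ => taylorW r f p.1 p.2) (taylorUmax r f D) := by
  rintro ⟨h₀, y₀⟩ hp
  refine ContDiffAt.contDiffWithinAt ?_
  obtain ⟨c, d, ε, hh₀, hε, e, he, hWe⟩ := exists_continuous_taylorW_sub_eq hD hf hp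
  set f₁ : ℝ → ℝ → ℝ →L[ℝ] ℝ := fun h y =>
    ContinuousLinearMap.toSpanSingleton ℝ (taylorField r f (taylorW r f h y) y)
  set f₂ : ℝ → ℝ → ℝ →L[ℝ] ℝ := fun h y => ContinuousLinearMap.toSpanSingleton ℝ (e (y, y) h)
  set V : Set (ℝ × ℝ) := (Ioo c d ×ˢ ball y₀ ε) ∩ taylorUmax r f D
  have hV : IsOpen V := (isOpen_Ioo.prod isOpen_ball).inter (isOpen_taylorUmax hD hf)
  have hspan : Continuous fun x : ℝ => ContinuousLinearMap.toSpanSingleton ℝ x :=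
    (ContinuousLinearMap.toSpanSingletonCLE (𝕜 := ℝ) (E := ℝ)).continuous
  have cf₁ : ContinuousOn (fun p : ℝ × ℝ => f₁ p.1 p.2) V := by
    refine hspan.comp_continuousOn ((contDiffOn_taylorField hD hf).continuousOn.comp
      (f := fun p : ℝ × ℝ => (taylorW r f p.1 p.2, p.2))
      (((continuousOn_taylorW hD hf).mono inter_subset_right).prodMk continuousOn_snd) ?_)
    exact fun p hp => ⟨mem_univ _, hp.2.1⟩
  have cf₂ : Continuous (fun p : ℝ × ℝ => f₂ p.1 p.2) :=
    hspan.comp (he.comp (f := fun p : ℝ × ℝ => ((p.2, p.2), p.1)) (by fun_prop))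
  have df₁ : ∀ p ∈ V, HasFDerivAt (fun h => taylorW r f h p.2) (f₁ p.1 p.2) p.1 := fun p hp =>
    (taylorW_hasDerivAt hp.2).hasFDerivAt
  have df₂ : ∀ p ∈ V, HasFDerivAt (fun y => taylorW r f p.1 y) (f₂ p.1 p.2) p.2 := by
    rintro ⟨h, y⟩ ⟨⟨hh, hy⟩, -⟩
    refine HasDerivAt.hasFDerivAt (hasDerivAt_iff_tendsto_slope.2 ?_)
    have hce : Continuous fun y' => e (y', y) h :=
      he.comp (f := fun y' => ((y', y), h)) (by fun_prop)
    refine ((hce.tendsto y).mono_left nhdsWithin_le_nhds).congr' ?_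
    filter_upwards [self_mem_nhdsWithin, mem_nhdsWithin_of_mem_nhds (isOpen_ball.mem_nhds hy)]
      with y' hne hy'
    rw [slope_def_field, hWe h hh y' (ball_subset_closedBall hy') y (ball_subset_closedBall hy),
      mul_div_cancel_left₀ _ (sub_ne_zero.2 hne)]
  refine contDiffAt_one_iff.2 ⟨fun p => (f₁ p.1 p.2).coprod (f₂ p.1 p.2), V,
    hV.mem_nhds ⟨⟨hh₀, mem_ball_self hε⟩, hp⟩, ?_, fun p hpV => ?_⟩
  · have : Continuous fun q : (ℝ →L[ℝ] ℝ) × (ℝ →L[ℝ] ℝ) => q.1.coprod q.2 :=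
      (ContinuousLinearMap.coprodEquivL (S := ℝ) (𝕜 := ℝ) (E := ℝ) (F := ℝ) (G := ℝ)).continuous
    exact this.comp_continuousOn (cf₁.prodMk cf₂.continuousOn)
  · exact (hasStrictFDerivAt_uncurry_coprod (f := taylorW r f) (f₁ := f₁) (f₂ := f₂)
      (eventually_of_mem (hV.mem_nhds hpV) df₁) (eventually_of_mem (hV.mem_nhds hpV) df₂)
      (cf₁.continuousAt (hV.mem_nhds hpV)) cf₂.continuousAt).hasFDerivAt

/-! ### Higher `h`-derivatives as polynomials in `w` -/

open Polynomial in
/-- The field `F(·, y)` as a polynomial. -/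
noncomputable def taylorFieldPoly (r : ℕ) (f : ℝ → ℝ) (y : ℝ) : ℝ[X] :=
  ∑ j ∈ Finset.range (r + 1), C (iteratedDeriv j f y / (j.factorial : ℝ)) * X ^ j

open Polynomial in
/-- The polynomial `P` with `∂_h^k Φ(h, y) = P(w(h, y))`. -/
noncomputable def taylorPhiDerivPoly (r : ℕ) (f : ℝ → ℝ) (y : ℝ) : ℕ → ℝ[X]
  | 0 => C y + X
  | k + 1 => derivative (taylorPhiDerivPoly r f y k) * taylorFieldPoly r f y

theorem eval_taylorFieldPoly (r : ℕ) (f : ℝ → ℝ) (w y : ℝ) :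
    (taylorFieldPoly r f y).eval w = taylorField r f w y := by
  simp [taylorFieldPoly, taylorField, Polynomial.eval_finsetSum]

/-- A family of polynomials of bounded degree with coefficients of class `C¹`. -/
structure IsC1PolyFamily (D : Set ℝ) (P : ℝ → Polynomial ℝ) : Prop where
  contDiffOn_coeff : ∀ i, ContDiffOn ℝ 1 (fun y => (P y).coeff i) D
  bddDegree : ∃ N, ∀ y, (P y).natDegree < N

theorem IsC1PolyFamily.mul {D : Set ℝ} {P Q : ℝ → Polynomial ℝ} (hP : IsC1PolyFamily D P)
    (hQ : IsC1PolyFamily D Q) : IsC1PolyFamily D fun y => P y * Q y := by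
  obtain ⟨N, hN⟩ := hP.bddDegree
  obtain ⟨M, hM⟩ := hQ.bddDegree
  refine ⟨fun i => ?_, N + M, fun y => ?_⟩
  · simp only [Polynomial.coeff_mul]
    exact ContDiffOn.sum fun j _ => (hP.contDiffOn_coeff _).mul (hQ.contDiffOn_coeff _)
  · have := Polynomial.natDegree_mul_le (p := P y) (q := Q y)
    have := hN y
    have := hM y
    omega

theorem IsC1PolyFamily.derivative {D : Set ℝ} {P : ℝ → Polynomial ℝ} (hP : IsC1PolyFamily D P) :
    IsC1PolyFamily D fun y => Polynomial.derivative (P y) := by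
  obtain ⟨N, hN⟩ := hP.bddDegree
  refine ⟨fun i => ?_, N, fun y => ?_⟩
  · simp only [Polynomial.coeff_derivative]
    exact (hP.contDiffOn_coeff _).mul contDiffOn_const
  · have := Polynomial.natDegree_derivative_le (P y)
    have := hN y
    omega

/-- The uniform degree bound makes evaluation a sum over a fixed finite range. -/
theorem IsC1PolyFamily.contDiffOn_eval {D : Set ℝ} {P : ℝ → Polynomial ℝ}
    (hP : IsC1PolyFamily D P) {w y : ℝ × ℝ → ℝ} {U : Set (ℝ × ℝ)} (hw : ContDiffOn ℝ 1 w U)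
    (hy : ContDiffOn ℝ 1 y U) (hyD : MapsTo y U D) :
    ContDiffOn ℝ 1 (fun p => (P (y p)).eval (w p)) U := by
  obtain ⟨N, hN⟩ := hP.bddDegree
  simp only [fun p => Polynomial.eval_eq_sum_range' (hN (y p)) (w p)]
  exact ContDiffOn.sum fun i _ => ((hP.contDiffOn_coeff i).comp hy hyD).mul (hw.pow i)

theorem isC1PolyFamily_taylorFieldPoly {r : ℕ} {f : ℝ → ℝ} {D : Set ℝ} (hD : IsOpen D)
    (hf : ContDiffOn ℝ ((r + 1 : ℕ) : WithTop ℕ∞) f D) :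
    IsC1PolyFamily D (taylorFieldPoly r f) := by
  refine ⟨fun i => ?_, r + 1, fun y => ?_⟩
  · simp only [taylorFieldPoly, Polynomial.finsetSum_coeff, Polynomial.coeff_C_mul]
    exact ContDiffOn.sum fun j hj =>
      (contDiffOn_taylorCoeff hD hf (Finset.mem_range.1 hj)).mul contDiffOn_const
  · refine Nat.lt_succ_of_le (Polynomial.natDegree_sum_le_of_forall_le _ _ fun j hj => ?_)
    exact (Polynomial.natDegree_C_mul_X_pow_le _ _).trans (Finset.mem_range_succ_iff.1 hj)

theorem isC1PolyFamily_taylorPhiDerivPoly {r : ℕ} {f : ℝ → ℝ} {D : Set ℝ} (hD : IsOpen D)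
    (hf : ContDiffOn ℝ ((r + 1 : ℕ) : WithTop ℕ∞) f D) (k : ℕ) :
    IsC1PolyFamily D fun y => taylorPhiDerivPoly r f y k := by
  induction k with
  | zero =>
    refine ⟨fun i => ?_, 2, fun y => ?_⟩
    · simp only [taylorPhiDerivPoly, Polynomial.coeff_add, Polynomial.coeff_C]
      refine ContDiffOn.add ?_ contDiffOn_const
      split_ifs
      · exact contDiffOn_id
      · exact contDiffOn_const
    · rw [taylorPhiDerivPoly, add_comm, Polynomial.natDegree_X_add_C]
      norm_num
  | succ k ih => exact ih.derivative.mul (isC1PolyFamily_taylorFieldPoly hD hf)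

/-- By openness the induction hypothesis holds for all times near `h`, so it can be differentiated
by the chain rule and the equation for `w`. -/
theorem taylorPhiDeriv_eq_eval {r : ℕ} {f : ℝ → ℝ} {D : Set ℝ} (hD : IsOpen D)
    (hf : ContDiffOn ℝ ((r + 1 : ℕ) : WithTop ℕ∞) f D) (k : ℕ) {h y : ℝ}
    (hp : (h, y) ∈ taylorUmax r f D) :
    taylorPhiDeriv r f k h y = (taylorPhiDerivPoly r f y k).eval (taylorW r f h y) := by
  induction k generalizing h with
  | zero => simp [taylorPhiDeriv, taylorPhiDerivPoly, taylorPhi]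
  | succ k ih =>
    have hev : (fun s => taylorPhiDeriv r f k s y) =ᶠ[𝓝 h]
        fun s => (taylorPhiDerivPoly r f y k).eval (taylorW r f s y) := by
      have : ∀ᶠ s in 𝓝 h, (s, y) ∈ taylorUmax r f D :=
        (Continuous.prodMk_left y).continuousAt.eventually
          ((isOpen_taylorUmax hD hf).mem_nhds hp)
      filter_upwards [this] with s hs using ih hs
    rw [taylorPhiDeriv, iteratedDeriv_succ]
    refine hev.deriv_eq.trans ?_
    refine (((taylorPhiDerivPoly r f y k).hasDerivAt _).comp h
      (taylorW_hasDerivAt hp)).deriv.trans ?_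
    rw [taylorPhiDerivPoly, Polynomial.eval_mul, eval_taylorFieldPoly]

theorem contDiffOn_taylorPhiDeriv {r : ℕ} {f : ℝ → ℝ} {D : Set ℝ} (hD : IsOpen D)
    (hf : ContDiffOn ℝ ((r + 1 : ℕ) : WithTop ℕ∞) f D) (k : ℕ) :
    ContDiffOn ℝ 1 (fun p : ℝ × ℝ => taylorPhiDeriv r f k p.1 p.2) (taylorUmax r f D) :=
  ((isC1PolyFamily_taylorPhiDerivPoly hD hf k).contDiffOn_eval (contDiffOn_taylorW hD hf)
    contDiffOn_snd fun _ hp => hp.1).congr fun _ hp => taylorPhiDeriv_eq_eval hD hf k hp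

/-! ### Uniform existence time and the theorem -/

/-- The tube lemma thickens `{0} × K` inside the open maximal domain. -/
theorem exists_Icc_prod_subset_taylorUmax {r : ℕ} {f : ℝ → ℝ} {D : Set ℝ} (hD : IsOpen D)
    (hf : ContDiffOn ℝ ((r + 1 : ℕ) : WithTop ℕ∞) f D) {K : Set ℝ} (hK : IsCompact K)
    (hKD : K ⊆ D) : ∃ h₀ : ℝ, 0 < h₀ ∧ Icc 0 h₀ ×ˢ K ⊆ taylorUmax r f D := by
  have hsub : ({0} : Set ℝ) ×ˢ K ⊆ taylorUmax r f D := by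
    rintro ⟨h, y⟩ ⟨rfl, hy⟩
    obtain ⟨u, a, b, hu⟩ := exists_isTaylorSolution r f y
    exact ⟨hKD hy, u, a, b, hu, hu.left_neg, hu.right_pos⟩
  obtain ⟨S, V, hS, -, h0S, hKV, hSV⟩ :=
    generalized_tube_lemma isCompact_singleton hK (isOpen_taylorUmax hD hf) hsub
  obtain ⟨ε, hε, hεS⟩ := nhds_basis_closedBall.mem_iff.1 (hS.mem_nhds (h0S rfl))
  refine ⟨ε, hε, (prod_mono (fun h hh => hεS ?_) hKV).trans hSV⟩
  rw [Real.closedBall_eq_Icc]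
  exact ⟨by linarith [hh.1], by linarith [hh.2]⟩

theorem proposition2p1 (r : ℕ) (D : Set ℝ) (hD : IsOpen D) (f : ℝ → ℝ)
    (hf : ContDiffOn ℝ ((r + 1 : ℕ) : WithTop ℕ∞) f D) :
    (IsOpen (taylorUmax r f D) ∧
      ∀ k : ℕ, ContDiffOn ℝ 1 (fun p : ℝ × ℝ => taylorPhiDeriv r f k p.1 p.2)
        (taylorUmax r f D)) ∧
    ∀ K : Set ℝ, IsCompact K → K ⊆ D →
      ∃ h₀ : ℝ, 0 < h₀ ∧ Icc 0 h₀ ×ˢ K ⊆ taylorUmax r f D ∧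
        ∃ L : ℝ, 0 ≤ L ∧ ∀ h ∈ Icc 0 h₀, ∀ y₁ ∈ K, ∀ y₂ ∈ K,
          |taylorPhiDeriv r f 1 h y₁ - taylorPhiDeriv r f 1 h y₂| ≤ L * |y₁ - y₂| := by
  refine ⟨⟨isOpen_taylorUmax hD hf, contDiffOn_taylorPhiDeriv hD hf⟩, fun K hK hKD => ?_⟩
  obtain ⟨h₀, hh₀, hsub⟩ := exists_Icc_prod_subset_taylorUmax hD hf hK hKD
  obtain ⟨L, hL⟩ := (contDiffOn_taylorPhiDeriv hD hf 1).exists_lipschitzOnWith_of_isCompact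
    (isOpen_taylorUmax hD hf) (isCompact_Icc.prod hK) hsub
  refine ⟨h₀, hh₀, hsub, L, L.2, fun h hh y₁ hy₁ y₂ hy₂ => ?_⟩
  simpa [Prod.dist_eq, Real.dist_eq] using hL.dist_le_mul (h, y₁) ⟨hh, hy₁⟩ (h, y₂) ⟨hh, hy₂⟩
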